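/- For a compact set $E \subset \mathbb{C}$, put $D = \widehat{\mathbb{C}} \setminus E$, where $\widehat{\mathbb{C}}$ is the Riemann sphere. Let $H^\infty(D)$ be the space of bounded analytic functions on $D$, and let $A(D)$ be the subspace of $H^\infty(D)$ of the functions that are continuous on $\widehat{\mathbb{C}}$ and analytic on $D$. With $f'(\infty) := \lim_{z\to\infty} z\,(f(z)-f(\infty))$, the analytic capacity and the continuous analytic capacity of $E$ are $$\gamma(E) := \sup\{|f'(\infty)| : f \in H^\infty(D),\ |f| \le 1 \text{ on } D\}, \qquad \alpha(E) := \sup\{|g'(\infty)| : g \in A(D),\ |g| \le 1 \text{ on } \mathbb{C}\}.$$ Let $E \subset \mathbb{C}$ be compact. 1. If $\gamma(E)=0$, then $\gamma(E\cup F)=\gamma(F)$ for every compact $F \subset \mathbb{C}$. 2. If $\alpha(E)=0$, then $\alpha(E\cup F)=\alpha(F)$ for every compact $F \subset \mathbb{C}$. 3. If $\gamma(E)=0$ and $U\subset\mathbb{C}$ is open (not necessarily containing $E$), then every bounded analytic function on $U\setminus E$ can be extended to a bounded analytic function on $U$. 4. If $\alpha(E)=0$ and $U\subset\mathbb{C}$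 is open (not necessarily containing $E$), then every bounded continuous function on $U$ which is analytic on $U\setminus E$ is analytic on the whole of $U$. -/

import Mathlib

open Filter Topology Set
open scoped ENNReal OnePoint

noncomputable section

namespace AnalyticCapacity

/-- The chart of the Riemann sphere `OnePoint ℂ` around `∞`: it sends `w ≠ 0` to `1 / w`
and `0` to `∞`. -/
def chartInfty (w : ℂ) : OnePoint ℂ :=
  if w = 0 then (∞ : OnePoint ℂ) else ((w⁻¹ : ℂ) : OnePoint ℂ)

/-- Analyticity of a function on the Riemann sphere at every point of `D` (an open set in all
uses below), read in the standard charts: `z` at finite points and `w = 1 / z` at `∞`. -/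
def SphereAnalyticOn (f : OnePoint ℂ → ℂ) (D : Set (OnePoint ℂ)) : Prop :=
  (∀ z : ℂ, (z : OnePoint ℂ) ∈ D → AnalyticAt ℂ (fun ζ : ℂ => f (ζ : OnePoint ℂ)) z) ∧
    ((∞ : OnePoint ℂ) ∈ D → AnalyticAt ℂ (fun w : ℂ => f (chartInfty w)) 0)

/-- The complement `D` of a plane set `E` in the Riemann sphere. -/
def sphereCompl (E : Set ℂ) : Set (OnePoint ℂ) :=
  ((fun z : ℂ => (z : OnePoint ℂ)) '' E)ᶜ

/-- `H^∞(D)`: bounded analytic functions on `D`. The values outside `D` are irrelevant. -/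
def Hinfty (D : Set (OnePoint ℂ)) : Set (OnePoint ℂ → ℂ) :=
  {f | SphereAnalyticOn f D ∧ ∃ C : ℝ, ∀ p ∈ D, ‖f p‖ ≤ C}

/-- `A(D)`: the functions of `H^∞(D)` that are continuous on the whole Riemann sphere. -/
def algebraA (D : Set (OnePoint ℂ)) : Set (OnePoint ℂ → ℂ) :=
  {g | g ∈ Hinfty D ∧ Continuous g}

/-- `f'(∞) = lim_{z → ∞} z (f(z) - f(∞))`. -/
def derivInfty (f : OnePoint ℂ → ℂ) : ℂ :=
  limUnder (Bornology.cobounded ℂ) (fun z : ℂ => z * (f (z : OnePoint ℂ) - f ∞))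

/-- The limit that defines `f'(∞)` exists whenever `f` is analytic at `∞`. -/
theorem tendsto_derivInfty {f : OnePoint ℂ → ℂ}
    (hf : AnalyticAt ℂ (fun w : ℂ => f (chartInfty w)) 0) :
    Tendsto (fun z : ℂ => z * (f (z : OnePoint ℂ) - f ∞)) (Bornology.cobounded ℂ)
      (𝓝 (derivInfty f)) := by
  have h := hf.differentiableAt.hasDerivAt.tendsto_slope
  have h2 := h.comp (tendsto_inv₀_cobounded' (α := ℂ))
  refine tendsto_nhds_limUnder ⟨_, h2.congr' ?_⟩
  filter_upwards [Bornology.eventually_ne_cobounded (0 : ℂ)] with z hz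
  simp [slope_def_field, chartInfty, hz, div_eq_mul_inv, mul_comm]

/-- The analytic capacity `γ(E)`, as a supremum in `[0, ∞]`. -/
def gamma (E : Set ℂ) : ℝ≥0∞ :=
  sSup {r | ∃ f ∈ Hinfty (sphereCompl E),
    (∀ p ∈ sphereCompl E, ‖f p‖ ≤ 1) ∧ r = ‖derivInfty f‖ₑ}

/-- The continuous analytic capacity `α(E)`, as a supremum in `[0, ∞]`. -/
def alpha (E : Set ℂ) : ℝ≥0∞ :=
  sSup {r | ∃ g ∈ algebraA (sphereCompl E),
    (∀ z : ℂ, ‖g (z : OnePoint ℂ)‖ ≤ 1) ∧ r = ‖derivInfty g‖ₑ}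

end AnalyticCapacity

end

namespace AnalyticCapacity

open MeasureTheory Metric

/-! The proof rests on localization in the sense of Vitushkin. Cut `f` off to a bounded function on
a disc about `a`, and integrate the difference quotient `(f ζ - f z) / (ζ - z)` against the weight
`ζ - a` over an annulus about `a`. As a function of `z` this is `T f - f * T 1`, where `T` is
`annulusTransform`. In polar coordinates `T 1` is seen to be a nonzero constant inside the annulus
and zero outside it, so it acts as a radial cut-off. The localization is bounded, tends to zero at
`∞` and is holomorphic off `E`: difference quotients are holomorphic where `f` is, and beyond the
annulus only the Cauchy transform `T f` remains.

Zero capacity kills such a function `h`: after scaling, `(h z - h z₀) / (z - z₀)` competes in the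
supremum and has derivative a multiple of `-h z₀` at `∞`, so `h z₀ = 0` (`eq_zero_of_gamma_eq_zero`,
`eq_zero_of_alpha_eq_zero`). Hence near `a` and off `E`, `f` is a constant multiple of `T f`, which
is holomorphic across `E`. This gives the two extension statements; the two union formulas are their
case `U = Fᶜ`. -/

/-- The Cauchy transform of `u` with respect to `μ`, without the factor `1 / π`. -/
noncomputable def cauchyTransform (μ : Measure ℂ) (u : ℂ → ℂ) (z : ℂ) : ℂ :=
  ∫ ζ, u ζ / (ζ - z) ∂μ

/-! ### Local integrability of the Cauchy kernel. -/

theorem lintegral_ball_inv_enorm_sub_le (z : ℂ) (ε : ℝ) :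
    ∫⁻ ζ in ball z ε, ‖ζ - z‖ₑ⁻¹ ≤ ENNReal.ofReal ε * ENNReal.ofReal (2 * Real.pi) := by
  have h1 : ∫⁻ ζ in ball z ε, ‖ζ - z‖ₑ⁻¹
      = ∫⁻ η : ℂ, (ball (0 : ℂ) ε).indicator (fun η => ‖η‖ₑ⁻¹) η := by
    rw [← lintegral_indicator measurableSet_ball,
      ← lintegral_sub_right_eq_self (fun η => (ball (0 : ℂ) ε).indicator _ η) z]
    refine lintegral_congr fun ζ => ?_
    by_cases h : ζ ∈ ball z ε
    · have h' : ζ - z ∈ ball (0 : ℂ) ε := by simpa [dist_eq_norm] using h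
      simp only [Set.indicator_of_mem h, Set.indicator_of_mem h']
    · have h' : ζ - z ∉ ball (0 : ℂ) ε := by simpa [dist_eq_norm] using h
      simp only [Set.indicator_of_notMem h, Set.indicator_of_notMem h']
  rw [h1, ← Complex.lintegral_comp_polarCoord_symm]
  calc _ ≤ ∫⁻ p in polarCoord.target,
        (Ioo (0 : ℝ) ε ×ˢ Ioo (-Real.pi) Real.pi).indicator 1 p := by
        refine setLIntegral_mono' (by simp only [polarCoord_target]; measurability) ?_
        rintro ⟨r, θ⟩ hp
        simp only [polarCoord_target, mem_prod, mem_Ioi] at hp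
        have hn : ‖Complex.polarCoord.symm (r, θ)‖ = r := by
          rw [Complex.norm_polarCoord_symm, abs_of_pos hp.1]
        by_cases h : r < ε
        · rw [Set.indicator_of_mem (by rwa [mem_ball_zero_iff, hn]),
            Set.indicator_of_mem (by exact ⟨⟨hp.1, h⟩, hp.2⟩)]
          rw [← ofReal_norm, hn]
          -- The Jacobian `r` of polar coordinates cancels the singularity `1 / r`.
          exact ENNReal.mul_inv_le_one _
        · rw [Set.indicator_of_notMem (by rwa [mem_ball_zero_iff, hn])]
          simp
    _ ≤ ∫⁻ p, (Ioo (0 : ℝ) ε ×ˢ Ioo (-Real.pi) Real.pi).indicator 1 p :=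
        setLIntegral_le_lintegral _ _
    _ = _ := by
        rw [lintegral_indicator_one (measurableSet_Ioo.prod measurableSet_Ioo),
          Measure.volume_eq_prod, Measure.prod_prod, Real.volume_Ioo, Real.volume_Ioo]
        congr 2 <;> ring

/-! ### Holomorphy of integrated difference quotients. -/

section Dslope

variable {μ : Measure ℂ} {f w : ℂ → ℂ} {M N : ℝ} {z₀ : ℂ}

theorem dslope_eq_div {f : ℂ → ℂ} {z ζ : ℂ} (h : ζ ≠ z) :
    dslope f ζ z = (f z - f ζ) / (z - ζ) := by
  rw [dslope_of_ne _ h.symm, slope_def_field]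

theorem ae_dslope_eq_div [NullSingletonClass μ] (f : ℂ → ℂ) (z : ℂ) :
    ∀ᵐ ζ ∂μ, dslope f ζ z = (f z - f ζ) / (z - ζ) := by
  filter_upwards [compl_mem_ae_iff.2 (measure_singleton (μ := μ) z)] with ζ hζ
  exact dslope_eq_div hζ

/-- Near a point where the bounded function `f` is holomorphic, the difference quotients of `f`
with arbitrary base point are holomorphic and uniformly bounded. -/
theorem exists_ball_dslope_bound (hfM : ∀ z, ‖f z‖ ≤ M)
    (hfd : ∀ᶠ z in 𝓝 z₀, DifferentiableAt ℂ f z) :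
    ∃ r > 0, ∃ K, ∀ ζ, DifferentiableOn ℂ (dslope f ζ) (ball z₀ r) ∧
      ∀ z ∈ ball z₀ r, ‖dslope f ζ z‖ ≤ K := by
  obtain ⟨R, hR, hd⟩ := Metric.eventually_nhds_iff_ball.1 hfd
  have hd' : DifferentiableOn ℂ f (ball z₀ R) := fun z hz => (hd z hz).differentiableWithinAt
  have hM : 0 ≤ M := (norm_nonneg _).trans (hfM z₀)
  -- Base points within `R / 3` of `z₀` are handled by the Schwarz lemma on `ball ζ (2 * R / 3)`.
  -- All others stay at distance at least `R / 6` from `z`, which gives the larger bound `2 * M / (R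
  -- / 6)`.
  refine ⟨R / 6, by positivity, 12 * M / R, fun ζ => ?_⟩
  by_cases hζ : ζ ∈ ball z₀ (R / 3)
  · have hζ' : dist ζ z₀ < R / 3 := hζ
    have hsub : ball ζ (2 * R / 3) ⊆ ball z₀ R := ball_subset_ball' (by linarith)
    refine ⟨((Complex.differentiableOn_dslope
      (isOpen_ball.mem_nhds (mem_ball.2 (by linarith)))).2 hd').mono
        (ball_subset_ball (by linarith)), fun z hz => ?_⟩
    have hz' : dist z z₀ < R / 6 := hz
    have := Complex.norm_dslope_le_div_of_mapsTo_ball (R₂ := 2 * M) (hd'.mono hsub)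
      (fun y _ => by
        rw [mem_closedBall, dist_eq_norm]
        linarith [norm_sub_le (f y) (f ζ), hfM y, hfM ζ])
      (show z ∈ ball ζ (2 * R / 3) by
        rw [mem_ball]; linarith [dist_triangle_right z ζ z₀])
    refine this.trans ?_
    rw [div_le_div_iff₀ (by positivity) hR]
    nlinarith
  · have hζ' : R / 3 ≤ dist ζ z₀ := by simpa using hζ
    have hfar : ∀ z ∈ ball z₀ (R / 6), R / 6 ≤ ‖z - ζ‖ := fun z hz => by
      have hz' : dist z z₀ < R / 6 := hz
      rw [← dist_eq_norm]
      linarith [dist_triangle_left ζ z₀ z]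
    refine ⟨(differentiableOn_dslope_of_notMem fun h => ?_).2
      (hd'.mono (ball_subset_ball (by linarith))), fun z hz => ?_⟩
    · have := hfar ζ h
      simp at this
      linarith
    · have h6 := hfar z hz
      have hne : ζ ≠ z := by
        rintro rfl
        simp at h6
        linarith
      rw [dslope_eq_div hne, norm_div, div_le_div_iff₀ (by linarith) hR]
      have h2 : ‖f z - f ζ‖ ≤ 2 * M := by linarith [norm_sub_le (f z) (f ζ), hfM z, hfM ζ]
      nlinarith [norm_nonneg (f z - f ζ)]

theorem aestronglyMeasurable_dslope_mul [NullSingletonClass μ] (hf : AEStronglyMeasurable f μ)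
    (hw : AEStronglyMeasurable w μ) (z : ℂ) :
    AEStronglyMeasurable (fun ζ => dslope f ζ z * w ζ) μ := by
  have h : AEStronglyMeasurable (fun ζ => (f z - f ζ) / (z - ζ) * w ζ) μ := by
    refine AEStronglyMeasurable.mul (AEMeasurable.aestronglyMeasurable ?_) hw
    exact (hf.aemeasurable.const_sub _).div (by fun_prop)
  refine h.congr ?_
  filter_upwards [ae_dslope_eq_div (μ := μ) f z] with ζ hζ
  rw [hζ]

theorem differentiableAt_integral_dslope_mul [IsFiniteMeasure μ] [NullSingletonClass μ]
    (hf : AEStronglyMeasurable f μ) (hw : AEStronglyMeasurable w μ)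
    (hfM : ∀ z, ‖f z‖ ≤ M) (hwN : ∀ᵐ ζ ∂μ, ‖w ζ‖ ≤ N)
    (hfd : ∀ᶠ z in 𝓝 z₀, DifferentiableAt ℂ f z) :
    DifferentiableAt ℂ (fun z => ∫ ζ, dslope f ζ z * w ζ ∂μ) z₀ := by
  obtain ⟨r, hr, K, hK⟩ := exists_ball_dslope_bound hfM hfd
  have hK0 : 0 ≤ K := (norm_nonneg _).trans ((hK z₀).2 z₀ (mem_ball_self hr))
  -- Cauchy estimate on circles of radius `r / 4`; the resulting Lipschitz constant does not depend
  -- on `ζ`.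
  have hlip : ∀ ζ, ∀ z ∈ ball z₀ (r / 2), ‖deriv (dslope f ζ) z‖ ≤ 4 * K / r := fun ζ z hz => by
    have hz' : dist z z₀ < r / 2 := hz
    have hsub : closedBall z (r / 4) ⊆ ball z₀ r := by
      intro y hy
      have hy' : dist y z ≤ r / 4 := hy
      rw [mem_ball]
      linarith [dist_triangle y z z₀]
    have := Complex.norm_deriv_le_of_forall_mem_sphere_norm_le (c := z) (R := r / 4) (C := K)
      (by positivity) (((hK ζ).1.mono hsub).diffContOnCl_ball subset_rfl)
      (fun y hy => (hK ζ).2 y (hsub (sphere_subset_closedBall hy)))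
    refine this.trans (le_of_eq ?_)
    field_simp
  have key := hasDerivAt_integral_of_dominated_loc_of_lip (μ := μ) (𝕜 := ℂ)
    (F := fun z ζ => dslope f ζ z * w ζ) (x₀ := z₀) (s := ball z₀ (r / 2))
    (bound := fun _ => 4 * K / r * N)
    -- The quotient rule, valid off the null set `ζ = z₀`; in this explicit form measurability in
    -- `ζ` is immediate.
    (F' := fun ζ => (deriv f z₀ * (z₀ - ζ) - (f z₀ - f ζ) * 1) / (z₀ - ζ) ^ 2 * w ζ)
    (ball_mem_nhds _ (by positivity))
    (Eventually.of_forall fun z => aestronglyMeasurable_dslope_mul hf hw z)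
    ?_ ?_ ?_ (integrable_const _) ?_
  · exact key.2.differentiableAt
  · refine Integrable.of_bound (aestronglyMeasurable_dslope_mul hf hw z₀) (K * N) ?_
    filter_upwards [hwN] with ζ hζ
    rw [norm_mul]
    exact mul_le_mul ((hK ζ).2 z₀ (mem_ball_self hr)) hζ (norm_nonneg _) hK0
  · refine AEStronglyMeasurable.mul (AEMeasurable.aestronglyMeasurable ?_) hw
    have := hf.aemeasurable
    fun_prop
  · filter_upwards [hwN] with ζ hζ
    have hN0 : 0 ≤ N := (norm_nonneg _).trans hζ
    refine LipschitzOnWith.of_dist_le_mul fun x hx y hy => ?_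
    have hb : ‖dslope f ζ x - dslope f ζ y‖ ≤ 4 * K / r * ‖x - y‖ :=
      (convex_ball z₀ (r / 2)).norm_image_sub_le_of_norm_deriv_le (𝕜 := ℂ)
        (fun t ht => (hK ζ).1.differentiableAt
          (isOpen_ball.mem_nhds (ball_subset_ball (by linarith) ht)))
        (hlip ζ) hy hx
    rw [dist_eq_norm, dist_eq_norm, ← sub_mul, norm_mul, Real.coe_nnabs,
      abs_of_nonneg (by positivity)]
    calc _ ≤ (4 * K / r * ‖x - y‖) * N := by gcongr
      _ = _ := by ring
  · filter_upwards [compl_mem_ae_iff.2 (measure_singleton (μ := μ) z₀)] with ζ hζ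
    have hne : z₀ ≠ ζ := fun h => hζ h.symm
    have h1 : HasDerivAt (fun z => (f z - f ζ) / (z - ζ))
        ((deriv f z₀ * (z₀ - ζ) - (f z₀ - f ζ) * 1) / (z₀ - ζ) ^ 2) z₀ :=
      (hfd.self_of_nhds.hasDerivAt.sub_const _).div ((hasDerivAt_id z₀).sub_const ζ)
        (sub_ne_zero.2 hne)
    refine (h1.congr_of_eventuallyEq ?_).mul_const _
    filter_upwards [isOpen_ne.mem_nhds hne] with z hz
    exact dslope_eq_div (Ne.symm hz)

end Dslope

/-! ### Cauchy transforms of bounded densities. -/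

section CauchyTransform

variable {A : Set ℂ} {u : ℂ → ℂ} {M : ℝ}

theorem lintegral_inter_ball_cauchyKernel_le (hA : MeasurableSet A)
    (hM : ∀ ζ ∈ A, ‖u ζ‖ ≤ M) (z : ℂ) (ε : ℝ) :
    ∫⁻ ζ in A ∩ ball z ε, ‖u ζ / (ζ - z)‖ₑ
      ≤ ENNReal.ofReal M * (ENNReal.ofReal ε * ENNReal.ofReal (2 * Real.pi)) := by
  calc ∫⁻ ζ in A ∩ ball z ε, ‖u ζ / (ζ - z)‖ₑ
      ≤ ∫⁻ ζ in A ∩ ball z ε, ENNReal.ofReal M * ‖ζ - z‖ₑ⁻¹ := by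
        refine setLIntegral_mono' (hA.inter measurableSet_ball) fun ζ hζ => ?_
        have h1 : ‖u ζ‖ₑ ≤ ENNReal.ofReal M := by
          rw [← ofReal_norm]
          exact ENNReal.ofReal_le_ofReal (hM ζ hζ.1)
        -- At `ζ = z` the quotient is `0` by convention, while `‖ζ - z‖ₑ⁻¹` is `⊤`.
        rcases eq_or_ne (ζ - z) 0 with h0 | h0
        · simp [h0]
        · rw [div_eq_mul_inv, enorm_mul, enorm_inv h0]
          gcongr
    _ ≤ ∫⁻ ζ in ball z ε, ENNReal.ofReal M * ‖ζ - z‖ₑ⁻¹ :=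
        lintegral_mono_set inter_subset_right
    _ = ENNReal.ofReal M * ∫⁻ ζ in ball z ε, ‖ζ - z‖ₑ⁻¹ :=
        lintegral_const_mul' _ _ ENNReal.ofReal_ne_top
    _ ≤ _ := by
        gcongr
        exact lintegral_ball_inv_enorm_sub_le z ε

theorem lintegral_cauchyKernel_le (hA : MeasurableSet A)
    (hM : ∀ ζ ∈ A, ‖u ζ‖ ≤ M) (z : ℂ) :
    ∫⁻ ζ in A, ‖u ζ / (ζ - z)‖ₑ
      ≤ ENNReal.ofReal M * ENNReal.ofReal (2 * Real.pi) + ENNReal.ofReal M * volume A := by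
  rw [← lintegral_inter_add_sdiff _ A (measurableSet_ball (x := z) (ε := 1))]
  refine add_le_add ?_ ?_
  · simpa using lintegral_inter_ball_cauchyKernel_le hA hM z 1
  · calc ∫⁻ ζ in A \ ball z 1, ‖u ζ / (ζ - z)‖ₑ
        ≤ ∫⁻ _ in A \ ball z 1, ENNReal.ofReal M := by
          refine setLIntegral_mono' (hA.diff measurableSet_ball) fun ζ hζ => ?_
          rw [← ofReal_norm]
          refine ENNReal.ofReal_le_ofReal ?_
          have h1 : 1 ≤ ‖ζ - z‖ := by simpa [dist_eq_norm] using hζ.2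
          rw [norm_div]
          exact (div_le_self (norm_nonneg _) h1).trans (hM ζ hζ.1)
      _ ≤ _ := by
          rw [setLIntegral_const]
          gcongr
          exact sdiff_subset

theorem integrableOn_cauchyKernel (hA : MeasurableSet A) (hfin : volume A ≠ ⊤)
    (hu : AEStronglyMeasurable u (volume.restrict A)) (hM : ∀ ζ ∈ A, ‖u ζ‖ ≤ M) (z : ℂ) :
    IntegrableOn (fun ζ => u ζ / (ζ - z)) A := by
  refine ⟨(hu.aemeasurable.div (by fun_prop)).aestronglyMeasurable, ?_⟩
  refine (lintegral_cauchyKernel_le hA hM z).trans_lt ?_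
  exact ENNReal.add_lt_top.2 ⟨ENNReal.mul_lt_top ENNReal.ofReal_lt_top ENNReal.ofReal_lt_top,
    ENNReal.mul_lt_top ENNReal.ofReal_lt_top hfin.lt_top⟩

theorem exists_norm_cauchyTransform_le (hA : MeasurableSet A) (hfin : volume A ≠ ⊤)
    (hM : ∀ ζ ∈ A, ‖u ζ‖ ≤ M) :
    ∃ C, ∀ z, ‖cauchyTransform (volume.restrict A) u z‖ ≤ C := by
  refine ⟨(ENNReal.ofReal M * ENNReal.ofReal (2 * Real.pi)
    + ENNReal.ofReal M * volume A).toReal, fun z => ?_⟩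
  refine (norm_integral_le_lintegral_norm _).trans (ENNReal.toReal_mono ?_ ?_)
  · exact ENNReal.add_ne_top.2 ⟨ENNReal.mul_ne_top ENNReal.ofReal_ne_top ENNReal.ofReal_ne_top,
      ENNReal.mul_ne_top ENNReal.ofReal_ne_top hfin⟩
  · simpa only [ofReal_norm] using lintegral_cauchyKernel_le hA hM z

/-- For `z` off `A`, `A.indicator u` vanishes at `z`, so its difference quotient with base point `ζ
∈ A` is `u ζ / (ζ - z)`. This makes the transform a case of `differentiableAt_integral_dslope_mul`
with weight `1`. -/
theorem differentiableAt_cauchyTransform (hA : MeasurableSet A) (hfin : volume A ≠ ⊤)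
    (hu : AEStronglyMeasurable u (volume.restrict A)) (hM : ∀ ζ ∈ A, ‖u ζ‖ ≤ M) {z₀ : ℂ}
    (hz₀ : Aᶜ ∈ 𝓝 z₀) :
    DifferentiableAt ℂ (cauchyTransform (volume.restrict A) u) z₀ := by
  have : IsFiniteMeasure (volume.restrict A) := ⟨by simpa using hfin.lt_top⟩
  have hv : A.indicator u =ᵐ[volume.restrict A] u := indicator_ae_eq_restrict hA
  have key := differentiableAt_integral_dslope_mul (μ := volume.restrict A)
    (f := A.indicator u) (w := fun _ => 1) (M := max M 0) (N := 1) (z₀ := z₀)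
    (hu.congr hv.symm) aestronglyMeasurable_const
    (fun z => by
      by_cases hz : z ∈ A
      · rw [indicator_of_mem hz]
        exact (hM z hz).trans (le_max_left _ _)
      · simp [indicator_of_notMem hz])
    (by simp)
    (by
      filter_upwards [eventually_mem_nhds_iff.2 hz₀] with z hz
      refine (differentiableAt_const (0 : ℂ)).congr_of_eventuallyEq ?_
      filter_upwards [hz] with y hy
      exact indicator_of_notMem hy _)
  refine key.congr_of_eventuallyEq ?_
  filter_upwards [hz₀] with z hz
  refine integral_congr_ae ?_
  filter_upwards [hv, ae_dslope_eq_div (μ := volume.restrict A) (A.indicator u) z] with ζ h1 h2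
  rw [h2, indicator_of_notMem hz, h1, mul_one, zero_sub, ← neg_sub ζ z, neg_div_neg_eq]

theorem continuous_cauchyTransform (hA : MeasurableSet A) (hfin : volume A ≠ ⊤)
    (hu : AEStronglyMeasurable u (volume.restrict A)) (hM : ∀ ζ ∈ A, ‖u ζ‖ ≤ M) :
    Continuous (cauchyTransform (volume.restrict A) u) := by
  rw [continuous_iff_continuousAt]
  intro z₀
  refine continuousAt_of_locally_uniform_approx_of_continuousAt fun s hs => ?_
  obtain ⟨δ, hδ, hs⟩ := Metric.mem_uniformity_dist.1 hs
  -- Deleting the `ε`-ball about `z₀` leaves a transform holomorphic near `z₀`, and changes the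
  -- values on that ball by at most `4 * π * ε * |M| < δ`. The `+ 1` covers `M = 0`.
  set ε : ℝ := δ / (4 * Real.pi * (|M| + 1)) / 2 with hε
  have hε0 : 0 < ε := by positivity
  refine ⟨ball z₀ ε, ball_mem_nhds _ hε0,
    cauchyTransform (volume.restrict (A \ ball z₀ ε)) u, ?_, fun y hy => hs ?_⟩
  · refine (differentiableAt_cauchyTransform (M := M) (hA.diff measurableSet_ball)
      (ne_top_of_le_ne_top hfin (measure_mono sdiff_subset))
      (hu.mono_measure (Measure.restrict_mono sdiff_subset le_rfl))
      (fun ζ hζ => hM ζ hζ.1) ?_).continuousAt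
    filter_upwards [ball_mem_nhds z₀ hε0] with ζ hζ h
    exact h.2 hζ
  · have hsplit : cauchyTransform (volume.restrict A) u y
        = (∫ ζ in A ∩ ball z₀ ε, u ζ / (ζ - y))
          + cauchyTransform (volume.restrict (A \ ball z₀ ε)) u y :=
      (integral_inter_add_sdiff measurableSet_ball
        (integrableOn_cauchyKernel hA hfin hu hM y)).symm
    rw [hsplit, dist_eq_norm, add_sub_cancel_right]
    have hsub : A ∩ ball z₀ ε ⊆ A ∩ ball y (2 * ε) := by
      refine inter_subset_inter_right _ (ball_subset_ball' ?_)
      have : dist y z₀ < ε := hy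
      rw [dist_comm]
      linarith
    have hle : ∫⁻ ζ in A ∩ ball z₀ ε, ENNReal.ofReal ‖u ζ / (ζ - y)‖
        ≤ ENNReal.ofReal (|M| * (2 * ε * (2 * Real.pi))) := by
      rw [ENNReal.ofReal_mul (abs_nonneg M), ENNReal.ofReal_mul (by positivity)]
      simp only [ofReal_norm]
      exact (lintegral_mono_set hsub).trans (lintegral_inter_ball_cauchyKernel_le hA
        (fun ζ hζ => (hM ζ hζ).trans (le_abs_self M)) y (2 * ε))
    refine ((norm_integral_le_lintegral_norm _).trans
      (ENNReal.toReal_le_of_le_ofReal (by positivity) hle)).trans_lt ?_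
    have hpi := Real.pi_pos
    have : (|M| + 1) * (2 * ε * (2 * Real.pi)) = δ / 2 := by
      rw [hε]
      field_simp
      norm_num
    nlinarith [mul_pos hε0 hpi]

theorem tendsto_cauchyTransform_cobounded (hA : MeasurableSet A) (hb : Bornology.IsBounded A)
    (hu : AEStronglyMeasurable u (volume.restrict A)) (hM : ∀ ζ ∈ A, ‖u ζ‖ ≤ M) :
    Tendsto (cauchyTransform (volume.restrict A) u) (Bornology.cobounded ℂ) (𝓝 0) := by
  have : IsFiniteMeasure (volume.restrict A) := ⟨by simpa using hb.measure_lt_top⟩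
  obtain ⟨R, hR⟩ := hb.exists_norm_le
  have : (Bornology.cobounded ℂ).IsCountablyGenerated := by
    rw [← comap_norm_atTop]
    infer_instance
  rw [← integral_zero ℂ ℂ (μ := volume.restrict A)]
  refine tendsto_integral_filter_of_dominated_convergence (fun _ => M)
    (Eventually.of_forall fun z =>
      (hu.aemeasurable.div (by fun_prop)).aestronglyMeasurable) ?_
    (integrable_const _) (Eventually.of_forall fun ζ => ?_)
  · filter_upwards [tendsto_norm_cobounded_atTop.eventually_ge_atTop (R + 1)] with z hz
    filter_upwards [ae_restrict_mem hA] with ζ hζ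
    have h1 : 1 ≤ ‖ζ - z‖ := by
      have := norm_sub_norm_le z ζ
      rw [norm_sub_rev]
      linarith [hR ζ hζ]
    rw [norm_div]
    exact (div_le_self (norm_nonneg _) h1).trans (hM ζ hζ)
  · have h : Tendsto (fun z : ℂ => ζ - z) (Bornology.cobounded ℂ) (Bornology.cobounded ℂ) :=
      tendsto_const_sub_cobounded ζ
    simpa [div_eq_mul_inv] using (tendsto_inv₀_cobounded.comp h).const_mul (u ζ)

end CauchyTransform

/-! ### The radial cut-off as a Cauchy transform. -/

section Annulus

/-- The open annulus with centre `a` and radii `r`, `R`. -/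
def annulus (a : ℂ) (r R : ℝ) : Set ℂ := ball a R \ closedBall a r

theorem measurableSet_annulus (a : ℂ) (r R : ℝ) : MeasurableSet (annulus a r R) :=
  measurableSet_ball.diff measurableSet_closedBall

theorem isBounded_annulus (a : ℂ) (r R : ℝ) : Bornology.IsBounded (annulus a r R) :=
  isBounded_ball.subset sdiff_subset

theorem circleIntegral_sub_inv_of_lt {w : ℂ} {s : ℝ} (hs : 0 ≤ s) (hw : s < ‖w‖) :
    ∮ ζ in C(0, s), (ζ - w)⁻¹ = 0 := by
  refine Complex.circleIntegral_eq_zero_of_differentiable_on_off_countable hs countable_empty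
    ?_ ?_
  · refine ContinuousOn.inv₀ (by fun_prop) fun ζ hζ h => ?_
    rw [sub_eq_zero.1 h, mem_closedBall_zero_iff] at hζ
    linarith
  · rintro ζ ⟨hζ, -⟩
    refine DifferentiableAt.inv (by fun_prop) fun h => ?_
    rw [sub_eq_zero.1 h, mem_ball_zero_iff] at hζ
    linarith

/-- On the circle `dζ = i ζ dθ`, and periodicity moves the interval to `[0, 2π]`. The weight `ζ - a`
thus turns the angular integral into a winding number. -/
theorem integral_Ioo_circleMap_div (w : ℂ) (s : ℝ) :
    ∫ θ in Ioo (-Real.pi) Real.pi, circleMap 0 s θ / (circleMap 0 s θ - w)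
      = -Complex.I * ∮ ζ in C(0, s), (ζ - w)⁻¹ := by
  have hper : Function.Periodic (fun θ => circleMap 0 s θ / (circleMap 0 s θ - w))
      (2 * Real.pi) := fun θ => by
    simp only [periodic_circleMap 0 s θ]
  have h := hper.intervalIntegral_add_eq (-Real.pi) 0
  rw [← integral_Ioc_eq_integral_Ioo, ← intervalIntegral.integral_of_le
    (by linarith [Real.pi_pos]), show (Real.pi : ℝ) = -Real.pi + 2 * Real.pi by ring]
  rw [show -(-Real.pi + 2 * Real.pi) = -Real.pi by ring]
  have h' : ∫ θ in (-Real.pi)..(-Real.pi + 2 * Real.pi),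
      circleMap 0 s θ / (circleMap 0 s θ - w) =
      ∫ θ in (0 : ℝ)..(2 * Real.pi), circleMap 0 s θ / (circleMap 0 s θ - w) := by
    rw [h, zero_add]
  rw [h', circleIntegral, ← intervalIntegral.integral_const_mul]
  refine intervalIntegral.integral_congr fun θ _ => ?_
  simp only [deriv_circleMap, smul_eq_mul]
  linear_combination ((circleMap 0 s θ / (circleMap 0 s θ - w))) * Complex.I_mul_I

theorem polarCoord_symm_eq_circleMap (s θ : ℝ) :
    Complex.polarCoord.symm (s, θ) = circleMap 0 s θ := by
  rw [Complex.polarCoord_symm_apply, circleMap, zero_add, Complex.exp_mul_I]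
  push_cast
  rfl

/-- The Cauchy transform of `ζ ↦ ζ - a` on an annulus around `a`, in polar coordinates. -/
theorem cauchyTransform_annulus_eq {a z : ℂ} {r R : ℝ} (hr : 0 < r)
    (hz : ∀ s ∈ Icc r R, ‖z - a‖ ≠ s) :
    cauchyTransform (volume.restrict (annulus a r R)) (fun ζ => ζ - a) z
      = ∫ s in Ioo r R, (s : ℂ) * (-Complex.I * ∮ ζ in C(0, s), (ζ - (z - a))⁻¹) := by
  set w := z - a with hw
  set g : ℂ → ℂ := fun η => η / (η - w) with hg
  have h1 : cauchyTransform (volume.restrict (annulus a r R)) (fun ζ => ζ - a) z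
      = ∫ η, (annulus 0 r R).indicator g η := by
    rw [cauchyTransform, ← integral_indicator (measurableSet_annulus a r R),
      ← integral_sub_right_eq_self (fun η => (annulus 0 r R).indicator g η) a]
    refine integral_congr_ae (Eventually.of_forall fun ζ => ?_)
    by_cases h : ζ ∈ annulus a r R
    · have h' : ζ - a ∈ annulus 0 r R := by
        simpa [annulus, dist_eq_norm] using h
      simp only [indicator_of_mem h, indicator_of_mem h', hg, hw]
      ring
    · have h' : ζ - a ∉ annulus 0 r R := by
        simpa [annulus, dist_eq_norm] using h
      simp only [indicator_of_notMem h, indicator_of_notMem h']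
  have h2 : ∫ η, (annulus 0 r R).indicator g η
      = ∫ p in Ioo r R ×ˢ Ioo (-Real.pi) Real.pi, (p.1 : ℂ) * g (circleMap 0 p.1 p.2) := by
    rw [← Complex.integral_comp_polarCoord_symm]
    have hS : MeasurableSet (Ioo r R ×ˢ Ioo (-Real.pi) Real.pi) :=
      measurableSet_Ioo.prod measurableSet_Ioo
    have hT : MeasurableSet polarCoord.target := polarCoord.open_target.measurableSet
    rw [← integral_indicator hS, ← integral_indicator hT]
    refine integral_congr_ae (Eventually.of_forall ?_)
    rintro ⟨s, θ⟩
    by_cases h : (s, θ) ∈ polarCoord.target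
    · have h' := h
      simp only [polarCoord_target, mem_prod, mem_Ioi] at h'
      simp only [indicator_of_mem h, polarCoord_symm_eq_circleMap]
      have hiff : circleMap 0 s θ ∈ annulus 0 r R ↔ s ∈ Ioo r R := by
        simp [annulus, abs_of_pos h'.1, and_comm]
      by_cases hs : s ∈ Ioo r R
      · rw [indicator_of_mem (hiff.2 hs), indicator_of_mem (by exact ⟨hs, h'.2⟩)]
        simp
      · rw [indicator_of_notMem (fun h => hs (hiff.1 h)), indicator_of_notMem fun h => hs h.1]
        simp
    · rw [indicator_of_notMem h, indicator_of_notMem]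
      rintro ⟨h1, h2⟩
      exact h (by simpa using ⟨hr.trans h1.1, h2⟩)
  -- Since `‖z - a‖` avoids `[r, R]`, the integrand is continuous on a compact rectangle; this is
  -- the integrability needed for Fubini.
  have hcont : ContinuousOn (fun p : ℝ × ℝ => (p.1 : ℂ) * g (circleMap 0 p.1 p.2))
      (Icc r R ×ˢ Icc (-Real.pi) Real.pi) := by
    have hc : Continuous fun p : ℝ × ℝ => circleMap 0 p.1 p.2 := by
      unfold circleMap
      fun_prop
    refine ContinuousOn.mul (by fun_prop)
      (hc.continuousOn.div (hc.continuousOn.sub continuousOn_const) fun p hp h => ?_)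
    refine hz p.1 hp.1 ?_
    rw [← sub_eq_zero.1 h, norm_circleMap_zero, abs_of_pos (hr.trans_le hp.1.1)]
  rw [h1, h2, Measure.volume_eq_prod, setIntegral_prod]
  · refine setIntegral_congr_fun measurableSet_Ioo fun s hs => ?_
    simp only [hg]
    rw [integral_const_mul, integral_Ioo_circleMap_div]
  · rw [← Measure.volume_eq_prod]
    exact (hcont.integrableOn_compact (isCompact_Icc.prod isCompact_Icc)).mono_set
      (prod_mono Ioo_subset_Icc_self Ioo_subset_Icc_self)

theorem cauchyTransform_annulus_of_lt {a z : ℂ} {r R : ℝ} (hr : 0 < r) (hz : ‖z - a‖ < r) :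
    cauchyTransform (volume.restrict (annulus a r R)) (fun ζ => ζ - a) z
      = ((2 * Real.pi * ∫ s in Ioo r R, s : ℝ) : ℂ) := by
  rw [cauchyTransform_annulus_eq hr fun s hs h => by linarith [hs.1],
    ← integral_const_mul, ← integral_complex_ofReal]
  refine setIntegral_congr_fun measurableSet_Ioo fun s hs => ?_
  rw [circleIntegral.integral_sub_inv_of_mem_ball
    (by rw [mem_ball_zero_iff]; exact hz.trans hs.1)]
  push_cast
  linear_combination (-(s : ℂ) * 2 * Real.pi) * Complex.I_mul_I

theorem cauchyTransform_annulus_of_gt {a z : ℂ} {r R : ℝ} (hr : 0 < r) (hz : R < ‖z - a‖) :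
    cauchyTransform (volume.restrict (annulus a r R)) (fun ζ => ζ - a) z = 0 := by
  rw [cauchyTransform_annulus_eq hr fun s hs h => by linarith [hs.2],
    setIntegral_eq_zero_of_forall_eq_zero]
  intro s hs
  rw [circleIntegral_sub_inv_of_lt (hr.trans hs.1).le (hs.2.trans hz), mul_zero, mul_zero]

theorem integral_Ioo_id_pos {r R : ℝ} (hr : 0 < r) (hrR : r < R) : 0 < ∫ s in Ioo r R, s := by
  rw [← integral_Ioc_eq_integral_Ioo, ← intervalIntegral.integral_of_le hrR.le, integral_id]
  nlinarith

end Annulus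

/-! ### Functions on the sphere and the consequences of zero capacity. -/

section SphereFunctions

/-- The function on the sphere with the value `c` at `∞` and the values of `k` at finite points. -/
def sphereExtend (k : ℂ → ℂ) (c : ℂ) (p : OnePoint ℂ) : ℂ := p.elim c k

@[simp] theorem sphereExtend_coe (k : ℂ → ℂ) (c z : ℂ) :
    sphereExtend k c (z : OnePoint ℂ) = k z := rfl

@[simp] theorem sphereExtend_infty (k : ℂ → ℂ) (c : ℂ) :
    sphereExtend k c (∞ : OnePoint ℂ) = c := rfl

@[simp] theorem coe_mem_sphereCompl {E : Set ℂ} {z : ℂ} :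
    (z : OnePoint ℂ) ∈ sphereCompl E ↔ z ∉ E := by
  simp [sphereCompl]

@[simp] theorem infty_mem_sphereCompl {E : Set ℂ} : (∞ : OnePoint ℂ) ∈ sphereCompl E := by
  simp [sphereCompl]

theorem forall_mem_sphereCompl {E : Set ℂ} {P : OnePoint ℂ → Prop} :
    (∀ p ∈ sphereCompl E, P p) ↔ P ∞ ∧ ∀ z : ℂ, z ∉ E → P z := by
  refine ⟨fun h => ⟨h _ infty_mem_sphereCompl, fun z hz => h _ (coe_mem_sphereCompl.2 hz)⟩,
    fun h p hp => ?_⟩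
  induction p using OnePoint.rec with
  | infty => exact h.1
  | coe z => exact h.2 z (coe_mem_sphereCompl.1 hp)

variable {E F : Set ℂ}

/-- In the chart at `∞`, `w = 0` is a removable singularity of `k w⁻¹`, with limit `c`. -/
theorem sphereAnalyticOn_sphereExtend {k : ℂ → ℂ} {c : ℂ} (hE : Bornology.IsBounded E)
    (hk : AnalyticOnNhd ℂ k Eᶜ) (hc : Tendsto k (Bornology.cobounded ℂ) (𝓝 c)) :
    SphereAnalyticOn (sphereExtend k c) (sphereCompl E) := by
  refine ⟨fun z hz => hk z (coe_mem_sphereCompl.1 hz), fun _ => ?_⟩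
  have hinv : Tendsto (fun w : ℂ => w⁻¹) (𝓝[≠] 0) (Bornology.cobounded ℂ) :=
    tendsto_inv₀_nhdsNE_zero
  have heq : ∀ w : ℂ, w ≠ 0 → sphereExtend k c (chartInfty w) = k w⁻¹ := fun w hw => by
    simp [chartInfty, hw]
  refine Complex.analyticAt_of_differentiable_on_punctured_nhds_of_continuousAt ?_ ?_
  · filter_upwards [hinv.eventually (Bornology.isBounded_def.1 hE), self_mem_nhdsWithin]
      with w hw hw0
    refine (DifferentiableAt.comp w (hk _ hw).differentiableAt
      (differentiableAt_inv hw0)).congr_of_eventuallyEq ?_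
    filter_upwards [isOpen_ne.mem_nhds hw0] with v hv
    exact heq v hv
  · rw [continuousAt_iff_punctured_nhds]
    have h0 : sphereExtend k c (chartInfty 0) = c := by simp [chartInfty]
    rw [h0]
    refine (hc.comp hinv).congr' ?_
    filter_upwards [self_mem_nhdsWithin] with v hv
    exact (heq v hv).symm

theorem continuous_sphereExtend {k : ℂ → ℂ} {c : ℂ} (hk : Continuous k)
    (hc : Tendsto k (Bornology.cobounded ℂ) (𝓝 c)) : Continuous (sphereExtend k c) := by
  rw [OnePoint.continuous_iff, coclosedCompact_eq_cocompact, ← Metric.cobounded_eq_cocompact]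
  exact ⟨hc, hk⟩

theorem derivInfty_eq_of_tendsto {f : OnePoint ℂ → ℂ} {d : ℂ}
    (h : Tendsto (fun z : ℂ => z * (f z - f ∞)) (Bornology.cobounded ℂ) (𝓝 d)) :
    derivInfty f = d :=
  h.limUnder_eq

theorem derivInfty_eq_zero_of_gamma_eq_zero (h : gamma E = 0) {f : OnePoint ℂ → ℂ}
    (hf : SphereAnalyticOn f (sphereCompl E)) (hb : ∀ p ∈ sphereCompl E, ‖f p‖ ≤ 1) :
    derivInfty f = 0 := by
  have h1 : ‖derivInfty f‖ₑ ≤ gamma E := le_sSup ⟨f, ⟨hf, 1, hb⟩, hb, rfl⟩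
  simpa [h] using h1

theorem derivInfty_eq_zero_of_alpha_eq_zero (h : alpha E = 0) {f : OnePoint ℂ → ℂ}
    (hf : SphereAnalyticOn f (sphereCompl E)) (hc : Continuous f)
    (hb : ∀ p, ‖f p‖ ≤ 1) : derivInfty f = 0 := by
  have h1 : ‖derivInfty f‖ₑ ≤ alpha E :=
    le_sSup ⟨f, ⟨⟨hf, 1, fun p _ => hb p⟩, hc⟩, fun z => hb z, rfl⟩
  simpa [h] using h1

theorem norm_infty_le_of_continuous {g : OnePoint ℂ → ℂ} (hg : Continuous g) {C : ℝ}
    (hC : ∀ z : ℂ, ‖g z‖ ≤ C) : ‖g ∞‖ ≤ C := by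
  have h := (OnePoint.continuous_iff g).1 hg
  rw [coclosedCompact_eq_cocompact] at h
  exact le_of_tendsto h.1.norm (Eventually.of_forall hC)

theorem alpha_le_gamma (E : Set ℂ) : alpha E ≤ gamma E := by
  refine sSup_le_sSup ?_
  rintro _ ⟨g, ⟨hg, hc⟩, hb, rfl⟩
  exact ⟨g, hg, forall_mem_sphereCompl.2 ⟨norm_infty_le_of_continuous hc hb, fun z _ => hb z⟩,
    rfl⟩

theorem tendsto_div_sub_cobounded (a : ℂ) :
    Tendsto (fun z : ℂ => z / (z - a)) (Bornology.cobounded ℂ) (𝓝 1) := by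
  have h : Tendsto (fun z : ℂ => 1 + a * (z - a)⁻¹) (Bornology.cobounded ℂ) (𝓝 (1 + a * 0)) :=
    ((tendsto_inv₀_cobounded.comp (tendsto_sub_const_cobounded a)).const_mul a).const_add 1
  rw [mul_zero, add_zero] at h
  refine h.congr' ?_
  filter_upwards [Bornology.eventually_ne_cobounded a] with z hz
  have : z - a ≠ 0 := sub_ne_zero.2 hz
  field_simp
  ring

theorem tendsto_inv_sub_cobounded (a : ℂ) :
    Tendsto (fun z : ℂ => (z - a)⁻¹) (Bornology.cobounded ℂ) (𝓝 0) :=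
  tendsto_inv₀_cobounded.comp (tendsto_sub_const_cobounded a)

section Vanishing

variable {h : ℂ → ℂ} {z₀ : ℂ}

theorem exists_dslope_bound {S : Set ℂ} {M : ℝ} (hM : ∀ z ∈ S, ‖h z‖ ≤ M) (hz₀ : z₀ ∈ S)
    (hd : DifferentiableAt ℂ h z₀) : ∃ K > 0, ∀ z ∈ S, ‖dslope h z₀ z‖ ≤ K := by
  have hc := (continuousAt_dslope_same.2 hd).norm
  obtain ⟨δ, hδ, hb⟩ := Metric.eventually_nhds_iff_ball.1
    (hc.eventually_lt_const (lt_add_one ‖dslope h z₀ z₀‖))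
  have hM0 : 0 ≤ M := (norm_nonneg _).trans (hM z₀ hz₀)
  refine ⟨(‖dslope h z₀ z₀‖ + 1) + 2 * M / δ, by positivity, fun z hz => ?_⟩
  by_cases hzδ : z ∈ ball z₀ δ
  · have h2 : 0 ≤ 2 * M / δ := by positivity
    linarith [hb z hzδ]
  · have hd : δ ≤ ‖z - z₀‖ := by simpa [dist_eq_norm] using hzδ
    have hne : z₀ ≠ z := by
      rintro rfl
      simp at hd
      linarith
    have h2 : ‖dslope h z₀ z‖ ≤ 2 * M / δ := by
      rw [dslope_eq_div hne, norm_div]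
      have : ‖h z - h z₀‖ ≤ 2 * M := by
        linarith [norm_sub_le (h z) (h z₀), hM z hz, hM z₀ hz₀]
      gcongr
    linarith [norm_nonneg (dslope h z₀ z₀)]

theorem tendsto_dslope_cobounded (h0 : Tendsto h (Bornology.cobounded ℂ) (𝓝 0)) (z₀ : ℂ) :
    Tendsto (dslope h z₀) (Bornology.cobounded ℂ) (𝓝 0) := by
  have := (h0.sub_const (h z₀)).mul (tendsto_inv_sub_cobounded z₀)
  rw [mul_zero] at this
  refine this.congr' ?_
  filter_upwards [Bornology.eventually_ne_cobounded z₀] with z hz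
  rw [dslope_eq_div hz.symm, div_eq_mul_inv]

/-- The quotient moves the value of `h` at `z₀` into the coefficient of `1 / z` at `∞`, where the
capacities can see it. -/
theorem tendsto_mul_dslope_cobounded (h0 : Tendsto h (Bornology.cobounded ℂ) (𝓝 0)) (z₀ : ℂ) :
    Tendsto (fun z => z * dslope h z₀ z) (Bornology.cobounded ℂ) (𝓝 (-h z₀)) := by
  have := (h0.sub_const (h z₀)).mul (tendsto_div_sub_cobounded z₀)
  rw [mul_one, zero_sub] at this
  refine this.congr' ?_
  filter_upwards [Bornology.eventually_ne_cobounded z₀] with z hz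
  rw [dslope_eq_div hz.symm]
  ring

theorem derivInfty_sphereExtend_dslope (h0 : Tendsto h (Bornology.cobounded ℂ) (𝓝 0))
    (z₀ K : ℂ) :
    derivInfty (sphereExtend (fun z => dslope h z₀ z / K) 0) = -h z₀ / K := by
  refine derivInfty_eq_of_tendsto ?_
  simpa [mul_div_assoc] using (tendsto_mul_dslope_cobounded h0 z₀).div_const K

theorem sphereAnalyticOn_sphereExtend_dslope (hE : IsCompact E)
    (hh : AnalyticOnNhd ℂ h Eᶜ) (h0 : Tendsto h (Bornology.cobounded ℂ) (𝓝 0)) (hz₀ : z₀ ∉ E)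
    (K : ℂ) :
    SphereAnalyticOn (sphereExtend (fun z => dslope h z₀ z / K) 0) (sphereCompl E) := by
  refine sphereAnalyticOn_sphereExtend hE.isBounded ?_
    (by simpa using (tendsto_dslope_cobounded h0 z₀).div_const K)
  have hopen : IsOpen Eᶜ := hE.isClosed.isOpen_compl
  have := ((Complex.differentiableOn_dslope (hopen.mem_nhds hz₀)).2 hh.differentiableOn)
  exact (this.div_const K).analyticOnNhd hopen

/-- A bounded holomorphic function off a set of zero analytic capacity which vanishes at `∞`
vanishes identically. -/
theorem eq_zero_of_gamma_eq_zero (hE : IsCompact E) (hγ : gamma E = 0)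
    (hh : AnalyticOnNhd ℂ h Eᶜ) {M : ℝ} (hM : ∀ z ∈ Eᶜ, ‖h z‖ ≤ M)
    (h0 : Tendsto h (Bornology.cobounded ℂ) (𝓝 0)) (hz₀ : z₀ ∉ E) : h z₀ = 0 := by
  obtain ⟨K, hK, hb⟩ := exists_dslope_bound hM hz₀ (hh z₀ hz₀).differentiableAt
  have := derivInfty_eq_zero_of_gamma_eq_zero hγ
    (sphereAnalyticOn_sphereExtend_dslope hE hh h0 hz₀ (K : ℂ))
    (forall_mem_sphereCompl.2 ⟨by simp, fun z hz => by
      simpa [abs_of_pos hK] using div_le_one_of_le₀ (hb z hz) hK.le⟩)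
  rw [derivInfty_sphereExtend_dslope h0] at this
  simpa [hK.ne'] using this

/-- A bounded continuous function on the plane which is holomorphic off a set of zero continuous
analytic capacity and vanishes at `∞` vanishes off that set. -/
theorem eq_zero_of_alpha_eq_zero (hE : IsCompact E) (hα : alpha E = 0) (hc : Continuous h)
    (hh : AnalyticOnNhd ℂ h Eᶜ) {M : ℝ} (hM : ∀ z, ‖h z‖ ≤ M)
    (h0 : Tendsto h (Bornology.cobounded ℂ) (𝓝 0)) (hz₀ : z₀ ∉ E) : h z₀ = 0 := by
  have hd := (hh z₀ hz₀).differentiableAt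
  obtain ⟨K, hK, hb⟩ := exists_dslope_bound (S := univ) (fun z _ => hM z) (mem_univ z₀) hd
  -- Continuity at `z₀` itself needs `h` differentiable there, hence `z₀ ∉ E`.
  have hcont : Continuous (dslope h z₀) := by
    rw [← continuousOn_univ, continuousOn_dslope univ_mem]
    exact ⟨hc.continuousOn, hd⟩
  have := derivInfty_eq_zero_of_alpha_eq_zero hα
    (sphereAnalyticOn_sphereExtend_dslope hE hh h0 hz₀ (K : ℂ))
    (continuous_sphereExtend (hcont.div_const _)
      (by simpa using (tendsto_dslope_cobounded h0 z₀).div_const (K : ℂ)))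
    (fun p => by
      induction p using OnePoint.rec with
      | infty => simp
      | coe z => simpa [abs_of_pos hK] using div_le_one_of_le₀ (hb z (mem_univ z)) hK.le)
  rw [derivInfty_sphereExtend_dslope h0] at this
  simpa [hK.ne'] using this

end Vanishing

/-- A set of zero continuous analytic capacity has empty interior. -/
theorem dense_compl_of_alpha_eq_zero (hE : IsCompact E) (hα : alpha E = 0) : Dense Eᶜ := by
  rw [← interior_eq_empty_iff_dense_compl]
  by_contra hne
  obtain ⟨a, ha⟩ := nonempty_iff_ne_empty.2 hne
  obtain ⟨R, hR, hsub⟩ := Metric.isOpen_iff.1 isOpen_interior a ha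
  set r := R / 2 with hr
  have hr0 : 0 < r := by positivity
  -- A competitor with nonzero derivative: `r / (z - a)` outside a disc contained in `E`, continued
  -- by `conj (z - a) / r` inside it.
  set k : ℂ → ℂ := fun z =>
    (r : ℂ) * (starRingEnd ℂ (z - a) / ((max (‖z - a‖ ^ 2) (r ^ 2) : ℝ) : ℂ)) with hk
  have hmax : ∀ z, 0 < max (‖z - a‖ ^ 2) (r ^ 2) := fun z => lt_max_of_lt_right (by positivity)
  have hkc : Continuous k := by
    refine continuous_const.mul (Continuous.div ?_ ?_ fun z => ?_)
    · exact Complex.continuous_conj.comp (by fun_prop)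
    · exact Complex.continuous_ofReal.comp (by fun_prop)
    · exact_mod_cast (hmax z).ne'
  have hkeq : ∀ z, r < ‖z - a‖ → k z = r * (z - a)⁻¹ := fun z hz => by
    have hza : z - a ≠ 0 := norm_pos_iff.1 (hr0.trans hz)
    rw [hk]
    simp only
    rw [max_eq_left (by gcongr), Complex.inv_def, Complex.normSq_eq_norm_sq, div_eq_mul_inv]
    push_cast
    rfl
  have hfar : ∀ᶠ z in Bornology.cobounded ℂ, r < ‖z - a‖ :=
    (tendsto_norm_cobounded_atTop.comp (tendsto_sub_const_cobounded a)).eventually_gt_atTop r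
  have hk0 : Tendsto k (Bornology.cobounded ℂ) (𝓝 0) := by
    have := (tendsto_inv_sub_cobounded a).const_mul (r : ℂ)
    rw [mul_zero] at this
    refine this.congr' ?_
    filter_upwards [hfar] with z hz
    exact (hkeq z hz).symm
  have hk1 : Tendsto (fun z => z * k z) (Bornology.cobounded ℂ) (𝓝 r) := by
    have := (tendsto_div_sub_cobounded a).const_mul (r : ℂ)
    rw [mul_one] at this
    refine this.congr' ?_
    filter_upwards [hfar] with z hz
    rw [hkeq z hz]
    ring
  have han : AnalyticOnNhd ℂ k Eᶜ := fun z hz => by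
    have hz' : r < ‖z - a‖ := by
      by_contra hle
      refine hz (interior_subset (hsub ?_))
      rw [mem_ball, dist_eq_norm]
      linarith
    have hopen : IsOpen {y : ℂ | r < ‖y - a‖} := isOpen_lt continuous_const (by fun_prop)
    have hne : z - a ≠ 0 := norm_pos_iff.1 (hr0.trans hz')
    have h1 : AnalyticAt ℂ (fun y : ℂ => (r : ℂ) * (y - a)⁻¹) z :=
      analyticAt_const.mul ((analyticAt_id.sub analyticAt_const).inv hne)
    refine h1.congr ?_
    filter_upwards [hopen.mem_nhds hz'] with y hy
    exact (hkeq y hy).symm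
  have hkb : ∀ z, ‖k z‖ ≤ 1 := fun z => by
    rw [hk]
    simp only [norm_mul, norm_div, Complex.norm_conj, Complex.norm_real, Real.norm_eq_abs,
      abs_of_pos hr0, abs_of_pos (hmax z)]
    rw [← mul_div_assoc]
    refine div_le_one_of_le₀ ?_ (hmax z).le
    nlinarith [le_max_left (‖z - a‖ ^ 2) (r ^ 2), le_max_right (‖z - a‖ ^ 2) (r ^ 2),
      sq_nonneg (‖z - a‖ - r)]
  have h0 := derivInfty_eq_zero_of_alpha_eq_zero hα
    (sphereAnalyticOn_sphereExtend hE.isBounded han hk0) (continuous_sphereExtend hkc hk0)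
    (fun p => by
      induction p using OnePoint.rec with
      | infty => simp
      | coe z => exact hkb z)
  rw [derivInfty_eq_of_tendsto (d := r) (by simpa using hk1)] at h0
  exact hr0.ne' (by exact_mod_cast h0)

end SphereFunctions

/-! ### The localization operator. -/

section Localization

variable {f : ℂ → ℂ} {a : ℂ} {r R M : ℝ}

/-- The Cauchy transform over an annulus around `a` of `f` times the weight `ζ ↦ ζ - a`. -/
noncomputable def annulusTransform (a : ℂ) (r R : ℝ) (f : ℂ → ℂ) : ℂ → ℂ :=
  cauchyTransform (volume.restrict (annulus a r R)) fun ζ => f ζ * (ζ - a)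

/-- The part of `f` whose singularities lie in the disc with centre `a` and radius `R`: up to sign
and a constant factor, the Vitushkin localization of `f` by a radial cut-off function. -/
noncomputable def localization (a : ℂ) (r R : ℝ) (f : ℂ → ℂ) (z : ℂ) : ℂ :=
  annulusTransform a r R f z - f z * annulusTransform a r R (fun _ => 1) z

theorem volume_annulus_ne_top (a : ℂ) (r R : ℝ) : volume (annulus a r R) ≠ ⊤ :=
  (isBounded_annulus a r R).measure_lt_top.ne

theorem norm_sub_le_of_mem_annulus {ζ : ℂ} (hζ : ζ ∈ annulus a r R) : ‖ζ - a‖ ≤ R := by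
  have := hζ.1
  rw [mem_ball, dist_eq_norm] at this
  exact this.le

theorem norm_mul_sub_le_of_mem_annulus (hM : ∀ z, ‖f z‖ ≤ M) {ζ : ℂ}
    (hζ : ζ ∈ annulus a r R) : ‖f ζ * (ζ - a)‖ ≤ M * R := by
  rw [norm_mul]
  exact mul_le_mul (hM ζ) (norm_sub_le_of_mem_annulus hζ) (norm_nonneg _)
    ((norm_nonneg _).trans (hM ζ))

theorem compl_annulus_mem_nhds_of_lt {z : ℂ} (hz : ‖z - a‖ < r) : (annulus a r R)ᶜ ∈ 𝓝 z := by
  have : z ∈ ball a r := by rwa [mem_ball, dist_eq_norm]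
  filter_upwards [isOpen_ball.mem_nhds this] with y hy h
  exact h.2 (ball_subset_closedBall hy)

theorem eventually_gt_norm_sub {z : ℂ} (hz : R < ‖z - a‖) : ∀ᶠ y in 𝓝 z, R < ‖y - a‖ :=
  (isOpen_lt continuous_const (by fun_prop : Continuous fun y : ℂ => ‖y - a‖)).mem_nhds hz

theorem compl_annulus_mem_nhds_of_gt {z : ℂ} (hz : R < ‖z - a‖) : (annulus a r R)ᶜ ∈ 𝓝 z := by
  filter_upwards [eventually_gt_norm_sub hz] with y hy h
  exact hy.not_ge (norm_sub_le_of_mem_annulus h)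

theorem annulusTransform_one_of_lt (hr : 0 < r) {z : ℂ} (hz : ‖z - a‖ < r) :
    annulusTransform a r R (fun _ => 1) z = ((2 * Real.pi * ∫ s in Ioo r R, s : ℝ) : ℂ) := by
  simpa only [annulusTransform, one_mul] using cauchyTransform_annulus_of_lt hr hz

theorem annulusTransform_one_of_gt (hr : 0 < r) {z : ℂ} (hz : R < ‖z - a‖) :
    annulusTransform a r R (fun _ => 1) z = 0 := by
  simpa only [annulusTransform, one_mul] using cauchyTransform_annulus_of_gt hr hz

theorem aestronglyMeasurable_mul_sub
    (hf : AEStronglyMeasurable f (volume.restrict (annulus a r R))) :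
    AEStronglyMeasurable (fun ζ => f ζ * (ζ - a)) (volume.restrict (annulus a r R)) :=
  hf.mul (by fun_prop)

theorem continuous_annulusTransform
    (hf : AEStronglyMeasurable f (volume.restrict (annulus a r R)))
    (hM : ∀ z, ‖f z‖ ≤ M) :
    Continuous (annulusTransform a r R f) :=
  continuous_cauchyTransform (measurableSet_annulus a r R) (volume_annulus_ne_top a r R)
    (aestronglyMeasurable_mul_sub hf) fun _ => norm_mul_sub_le_of_mem_annulus hM

theorem differentiableAt_annulusTransform
    (hf : AEStronglyMeasurable f (volume.restrict (annulus a r R)))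
    (hM : ∀ z, ‖f z‖ ≤ M) {z : ℂ}
    (hz : (annulus a r R)ᶜ ∈ 𝓝 z) : DifferentiableAt ℂ (annulusTransform a r R f) z :=
  differentiableAt_cauchyTransform (measurableSet_annulus a r R) (volume_annulus_ne_top a r R)
    (aestronglyMeasurable_mul_sub hf) (fun _ => norm_mul_sub_le_of_mem_annulus hM) hz

theorem analyticAt_annulusTransform
    (hf : AEStronglyMeasurable f (volume.restrict (annulus a r R)))
    (hM : ∀ z, ‖f z‖ ≤ M) (hr : 0 < r) :
    AnalyticAt ℂ (annulusTransform a r R f) a := by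
  refine DifferentiableOn.analyticAt (s := ball a r) (fun z hz => ?_) (ball_mem_nhds a hr)
  rw [mem_ball, dist_eq_norm] at hz
  exact (differentiableAt_annulusTransform hf hM
    (compl_annulus_mem_nhds_of_lt hz)).differentiableWithinAt

theorem integrable_annulusTransform_kernel
    (hf : AEStronglyMeasurable f (volume.restrict (annulus a r R)))
    (hM : ∀ z, ‖f z‖ ≤ M) (z : ℂ) :
    IntegrableOn (fun ζ => f ζ * (ζ - a) / (ζ - z)) (annulus a r R) :=
  integrableOn_cauchyKernel (measurableSet_annulus a r R) (volume_annulus_ne_top a r R)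
    (aestronglyMeasurable_mul_sub hf) (fun _ => norm_mul_sub_le_of_mem_annulus hM) z

/-- This form gives holomorphy wherever `f` is holomorphic, including points of the annulus, where
neither term of the definition need be holomorphic. -/
theorem localization_eq_integral_dslope
    (hf : AEStronglyMeasurable f (volume.restrict (annulus a r R)))
    (hM : ∀ z, ‖f z‖ ≤ M) (z : ℂ) :
    localization a r R f z = ∫ ζ in annulus a r R, dslope f ζ z * (ζ - a) := by
  have h1 := integrable_annulusTransform_kernel hf hM z
  have h2 := integrable_annulusTransform_kernel (f := fun _ => 1) (a := a) (r := r) (R := R)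
    aestronglyMeasurable_const (M := 1) (by simp) z
  rw [localization, annulusTransform, annulusTransform, cauchyTransform, cauchyTransform,
    ← integral_const_mul, ← integral_sub h1 (h2.const_mul (f z))]
  refine integral_congr_ae ?_
  filter_upwards [ae_dslope_eq_div (μ := volume.restrict (annulus a r R)) f z] with ζ hζ
  rw [hζ, ← neg_sub ζ z, ← neg_sub (f ζ) (f z), neg_div_neg_eq]
  ring

theorem differentiableAt_localization
    (hf : AEStronglyMeasurable f (volume.restrict (annulus a r R)))
    (hM : ∀ z, ‖f z‖ ≤ M) {z₀ : ℂ}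
    (hd : ∀ᶠ z in 𝓝 z₀, DifferentiableAt ℂ f z) :
    DifferentiableAt ℂ (localization a r R f) z₀ := by
  have : IsFiniteMeasure (volume.restrict (annulus a r R)) :=
    ⟨by simpa using (isBounded_annulus a r R).measure_lt_top⟩
  have key := differentiableAt_integral_dslope_mul (w := fun ζ => ζ - a) (N := R) hf
    (by fun_prop) hM (by
      filter_upwards [ae_restrict_mem (measurableSet_annulus a r R)] with ζ hζ
      exact norm_sub_le_of_mem_annulus hζ) hd
  exact key.congr_of_eventuallyEq
    (Eventually.of_forall fun z => localization_eq_integral_dslope hf hM z)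

/-- Beyond the outer radius the cut-off is zero, so the value `f z` drops out and the jump of a
truncated `f` does no harm. -/
theorem localization_eventuallyEq_of_gt (hr : 0 < r) {z₀ : ℂ} (hz₀ : R < ‖z₀ - a‖) :
    localization a r R f =ᶠ[𝓝 z₀] annulusTransform a r R f := by
  filter_upwards [eventually_gt_norm_sub hz₀] with z hz
  rw [localization, annulusTransform_one_of_gt hr hz, mul_zero, sub_zero]

theorem differentiableAt_localization_of_gt
    (hf : AEStronglyMeasurable f (volume.restrict (annulus a r R)))
    (hM : ∀ z, ‖f z‖ ≤ M) (hr : 0 < r) {z₀ : ℂ}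
    (hz₀ : R < ‖z₀ - a‖) : DifferentiableAt ℂ (localization a r R f) z₀ :=
  (differentiableAt_annulusTransform hf hM
    (compl_annulus_mem_nhds_of_gt hz₀)).congr_of_eventuallyEq
    (localization_eventuallyEq_of_gt hr hz₀)

theorem tendsto_localization_cobounded
    (hf : AEStronglyMeasurable f (volume.restrict (annulus a r R)))
    (hM : ∀ z, ‖f z‖ ≤ M) (hr : 0 < r) :
    Tendsto (localization a r R f) (Bornology.cobounded ℂ) (𝓝 0) := by
  have h : Tendsto (annulusTransform a r R f) (Bornology.cobounded ℂ) (𝓝 0) :=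
    tendsto_cauchyTransform_cobounded (measurableSet_annulus a r R) (isBounded_annulus a r R)
      (aestronglyMeasurable_mul_sub hf) fun _ => norm_mul_sub_le_of_mem_annulus hM
  refine h.congr' ?_
  filter_upwards [(tendsto_norm_cobounded_atTop.comp
    (tendsto_sub_const_cobounded a)).eventually_gt_atTop R] with z hz
  exact (localization_eventuallyEq_of_gt hr hz).self_of_nhds.symm

theorem exists_norm_localization_le (hM : ∀ z, ‖f z‖ ≤ M) :
    ∃ C, ∀ z, ‖localization a r R f z‖ ≤ C := by
  obtain ⟨C₁, h₁⟩ := exists_norm_cauchyTransform_le (measurableSet_annulus a r R)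
    (volume_annulus_ne_top a r R)
    (fun _ => norm_mul_sub_le_of_mem_annulus (f := f) (a := a) (r := r) (R := R) hM)
  obtain ⟨C₂, h₂⟩ := exists_norm_cauchyTransform_le (measurableSet_annulus a r R)
    (volume_annulus_ne_top a r R)
    (fun _ => norm_mul_sub_le_of_mem_annulus (f := fun _ => 1) (a := a) (r := r) (R := R)
      (M := 1) (by simp))
  refine ⟨C₁ + M * C₂, fun z => (norm_sub_le _ _).trans (add_le_add (h₁ z) ?_)⟩
  rw [norm_mul]
  exact mul_le_mul (hM z) (h₂ z) (norm_nonneg _) ((norm_nonneg _).trans (hM z))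

theorem continuousAt_localization
    (hf : AEStronglyMeasurable f (volume.restrict (annulus a r R)))
    (hM : ∀ z, ‖f z‖ ≤ M) {z₀ : ℂ} (hc : ContinuousAt f z₀) :
    ContinuousAt (localization a r R f) z₀ :=
  (continuous_annulusTransform hf hM).continuousAt.sub (hc.mul
    (continuous_annulusTransform (M := 1) aestronglyMeasurable_const (by simp)).continuousAt)

theorem continuousAt_localization_of_gt
    (hf : AEStronglyMeasurable f (volume.restrict (annulus a r R)))
    (hM : ∀ z, ‖f z‖ ≤ M) (hr : 0 < r) {z₀ : ℂ}
    (hz₀ : R < ‖z₀ - a‖) : ContinuousAt (localization a r R f) z₀ :=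
  (differentiableAt_localization_of_gt hf hM hr hz₀).continuousAt

/-- Where the localization of `f` vanishes near `a`, `f` is a multiple of its annulus
transform. -/
theorem eq_annulusTransform_div (hr : 0 < r) (hrR : r < R) {z : ℂ} (hz : ‖z - a‖ < r)
    (h : localization a r R f z = 0) :
    annulusTransform a r R f z / ((2 * Real.pi * ∫ s in Ioo r R, s : ℝ) : ℂ) = f z := by
  rw [localization, annulusTransform_one_of_lt hr hz, sub_eq_zero] at h
  have hpos : (0 : ℝ) < 2 * Real.pi * ∫ s in Ioo r R, s :=
    mul_pos (by positivity) (integral_Ioo_id_pos hr hrR)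
  rw [h, mul_div_cancel_right₀]
  exact_mod_cast hpos.ne'

end Localization

/-! ### Extension across sets of zero capacity. -/

variable {E U : Set ℂ} {f : ℂ → ℂ} {C : ℝ}

theorem norm_indicator_le_max {S : Set ℂ} (hC : ∀ z ∈ S, ‖f z‖ ≤ C) (z : ℂ) :
    ‖S.indicator f z‖ ≤ max C 0 := by
  by_cases hz : z ∈ S
  · rw [indicator_of_mem hz]
    exact (hC z hz).trans (le_max_left _ _)
  · simp [indicator_of_notMem hz]

theorem indicator_eventuallyEq_of_mem {S : Set ℂ} (hS : IsOpen S) {z : ℂ} (hz : z ∈ S) :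
    S.indicator f =ᶠ[𝓝 z] f := by
  filter_upwards [hS.mem_nhds hz] with y hy
  exact indicator_of_mem hy f

theorem aestronglyMeasurable_indicator_of_continuousOn {S : Set ℂ} (hS : IsOpen S)
    (hf : ContinuousOn f S) (μ : Measure ℂ) : AEStronglyMeasurable (S.indicator f) μ :=
  (aestronglyMeasurable_indicator_iff hS.measurableSet).2
    (hf.aestronglyMeasurable hS.measurableSet)

theorem eventually_differentiableAt_indicator {S T : Set ℂ} (hS : IsOpen S) (hT : IsOpen T)
    (hTS : T ⊆ S) (hf : AnalyticOnNhd ℂ f T) {z : ℂ} (hz : z ∈ T) :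
    ∀ᶠ y in 𝓝 z, DifferentiableAt ℂ (S.indicator f) y := by
  filter_upwards [hT.mem_nhds hz] with y hy
  exact (hf y hy).differentiableAt.congr_of_eventuallyEq
    (indicator_eventuallyEq_of_mem hS (hTS hy))

/-- Bounded holomorphic functions extend locally across sets of zero analytic capacity. -/
theorem exists_local_extension (hE : IsCompact E) (hγ : gamma E = 0) (hU : IsOpen U)
    (hf : AnalyticOnNhd ℂ f (U \ E)) (hC : ∀ z ∈ U \ E, ‖f z‖ ≤ C) {a : ℂ} (ha : a ∈ U) :
    ∃ g : ℂ → ℂ, AnalyticAt ℂ g a ∧ ∀ᶠ z in 𝓝 a, z ∉ E → g z = f z := by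
  obtain ⟨ρ, hρ, hsub⟩ := Metric.isOpen_iff.1 hU a ha
  have hS : IsOpen (ball a ρ \ E) := isOpen_ball.sdiff hE.isClosed
  have hSU : ball a ρ \ E ⊆ U \ E := sdiff_subset_sdiff_left hsub
  -- Setting `f` to zero on `E` costs nothing, since the localization has to be holomorphic only off
  -- `E`. The outer radius `ρ / 2` puts every point outside the ball beyond the annulus.
  set F := (ball a ρ \ E).indicator f with hF
  have hM := norm_indicator_le_max (f := f) fun z hz => hC z (hSU hz)
  have hmeas := aestronglyMeasurable_indicator_of_continuousOn hS
    (hf.mono hSU).continuousOn (volume.restrict (annulus a (ρ / 4) (ρ / 2)))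
  have hr : 0 < ρ / 4 := by positivity
  have han : AnalyticOnNhd ℂ (localization a (ρ / 4) (ρ / 2) F) Eᶜ := by
    refine DifferentiableOn.analyticOnNhd (fun z hz => ?_) hE.isClosed.isOpen_compl
    refine DifferentiableAt.differentiableWithinAt ?_
    by_cases hzb : z ∈ ball a ρ
    · exact differentiableAt_localization hmeas hM
        (eventually_differentiableAt_indicator hS hS subset_rfl (hf.mono hSU) ⟨hzb, hz⟩)
    · rw [mem_ball, dist_eq_norm] at hzb
      exact differentiableAt_localization_of_gt hmeas hM hr (by linarith)
  obtain ⟨C', hC'⟩ := exists_norm_localization_le (a := a) (r := ρ / 4) (R := ρ / 2) hM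
  refine ⟨fun z => annulusTransform a (ρ / 4) (ρ / 2) F z /
    ((2 * Real.pi * ∫ s in Ioo (ρ / 4) (ρ / 2), s : ℝ) : ℂ),
    (analyticAt_annulusTransform hmeas hM hr).div_const, ?_⟩
  filter_upwards [ball_mem_nhds a hr] with z hz hzE
  have hz' : ‖z - a‖ < ρ / 4 := by rwa [mem_ball, dist_eq_norm] at hz
  have hzS : z ∈ ball a ρ \ E := ⟨ball_subset_ball (by linarith) hz, hzE⟩
  rw [eq_annulusTransform_div hr (by linarith) hz' (eq_zero_of_gamma_eq_zero hE hγ han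
    (fun y _ => hC' y) (tendsto_localization_cobounded hmeas hM hr) hzE), hF,
    indicator_of_mem hzS]

theorem analyticOnNhd_of_alpha_eq_zero (hE : IsCompact E) (hα : alpha E = 0) (hU : IsOpen U)
    (hc : ContinuousOn f U) (hC : ∀ z ∈ U, ‖f z‖ ≤ C) (hf : AnalyticOnNhd ℂ f (U \ E)) :
    AnalyticOnNhd ℂ f U := by
  intro a ha
  obtain ⟨ρ, hρ, hsub⟩ := Metric.isOpen_iff.1 hU a ha
  have hB : IsOpen (ball a ρ) := isOpen_ball
  -- The values on `E` are kept here, because competitors for `alpha` must be continuous across `E`.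
  set F := (ball a ρ).indicator f with hF
  have hM := norm_indicator_le_max (f := f) fun z hz => hC z (hsub hz)
  have hmeas := aestronglyMeasurable_indicator_of_continuousOn hB
    (hc.mono hsub) (volume.restrict (annulus a (ρ / 4) (ρ / 2)))
  have hr : 0 < ρ / 4 := by positivity
  have hfar : ∀ z ∉ ball a ρ, ρ / 2 < ‖z - a‖ := fun z hz => by
    rw [mem_ball, dist_eq_norm] at hz
    linarith
  have han : AnalyticOnNhd ℂ (localization a (ρ / 4) (ρ / 2) F) Eᶜ := by
    refine DifferentiableOn.analyticOnNhd (fun z hz => ?_) hE.isClosed.isOpen_compl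
    refine DifferentiableAt.differentiableWithinAt ?_
    by_cases hzb : z ∈ ball a ρ
    · exact differentiableAt_localization hmeas hM
        (eventually_differentiableAt_indicator hB (hB.sdiff hE.isClosed) sdiff_subset
          (hf.mono (sdiff_subset_sdiff_left hsub)) ⟨hzb, hz⟩)
    · exact differentiableAt_localization_of_gt hmeas hM hr (hfar z hzb)
  have hcont : Continuous (localization a (ρ / 4) (ρ / 2) F) := by
    refine continuous_iff_continuousAt.2 fun z => ?_
    by_cases hzb : z ∈ ball a ρ
    · exact continuousAt_localization hmeas hM ((hc.continuousAt
        (hU.mem_nhds (hsub hzb))).congr (indicator_eventuallyEq_of_mem hB hzb).symm)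
    · exact continuousAt_localization_of_gt hmeas hM hr (hfar z hzb)
  obtain ⟨C', hC'⟩ := exists_norm_localization_le (a := a) (r := ρ / 4) (R := ρ / 2) hM
  -- Vanishing off `E` spreads to the whole plane by continuity and density.
  have hzero : localization a (ρ / 4) (ρ / 2) F = fun _ => 0 :=
    hcont.ext_on (dense_compl_of_alpha_eq_zero hE hα) continuous_const fun z hz =>
      eq_zero_of_alpha_eq_zero hE hα hcont han hC'
        (tendsto_localization_cobounded hmeas hM hr) hz
  refine ((analyticAt_annulusTransform hmeas hM hr).div_const
    (c := ((2 * Real.pi * ∫ s in Ioo (ρ / 4) (ρ / 2), s : ℝ) : ℂ))).congr ?_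
  filter_upwards [ball_mem_nhds a hr] with z hz
  have hz' : ‖z - a‖ < ρ / 4 := by rwa [mem_ball, dist_eq_norm] at hz
  rw [eq_annulusTransform_div hr (by linarith) hz' (congrFun hzero z), hF,
    indicator_of_mem (ball_subset_ball (by linarith) hz)]

theorem exists_analytic_extension (hE : IsCompact E) (hγ : gamma E = 0) (hU : IsOpen U)
    (hf : AnalyticOnNhd ℂ f (U \ E)) (hC : ∀ z ∈ U \ E, ‖f z‖ ≤ C) :
    ∃ g : ℂ → ℂ, AnalyticOnNhd ℂ g U ∧ (∀ z ∈ U, ‖g z‖ ≤ C) ∧ EqOn g f (U \ E) := by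
  have hdense : Dense Eᶜ :=
    dense_compl_of_alpha_eq_zero hE (le_antisymm ((alpha_le_gamma E).trans hγ.le) bot_le)
  have hne : ∀ z : ℂ, (𝓝[Eᶜ] z).NeBot := fun z => mem_closure_iff_nhdsWithin_neBot.1 (hdense z)
  -- Limits along the dense set `Eᶜ` agree with every local extension, so these glue without choices
  -- and keep the bound `C`.
  set g : ℂ → ℂ := fun z => limUnder (𝓝[Eᶜ] z) f with hg
  have hgt : ∀ (z : ℂ) (k : ℂ → ℂ), ContinuousAt k z → (∀ᶠ y in 𝓝 z, y ∉ E → k y = f y) →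
      Tendsto f (𝓝[Eᶜ] z) (𝓝 (k z)) := fun z k hk heq =>
    (hk.tendsto.mono_left nhdsWithin_le_nhds).congr' (eventually_nhdsWithin_iff.2 heq)
  have hgeq : ∀ (z : ℂ) (k : ℂ → ℂ), ContinuousAt k z → (∀ᶠ y in 𝓝 z, y ∉ E → k y = f y) →
      g z = k z := fun z k hk heq => (hgt z k hk heq).limUnder_eq
  refine ⟨g, fun z hz => ?_, fun z hz => ?_, fun z hz => ?_⟩
  · obtain ⟨k, hk, heq⟩ := exists_local_extension hE hγ hU hf hC hz
    refine hk.congr ?_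
    filter_upwards [hk.eventually_analyticAt, eventually_eventually_nhds.2 heq] with y hy hy'
    exact (hgeq y k hy.continuousAt hy').symm
  · obtain ⟨k, hk, heq⟩ := exists_local_extension hE hγ hU hf hC hz
    rw [hgeq z k hk.continuousAt heq]
    refine le_of_tendsto (hgt z k hk.continuousAt heq).norm ?_
    filter_upwards [self_mem_nhdsWithin, mem_nhdsWithin_of_mem_nhds (hU.mem_nhds hz)]
      with y hyE hyU
    exact hC y ⟨hyU, hyE⟩
  · exact hgeq z f (hf z hz).continuousAt (Eventually.of_forall fun _ _ => rfl)

/-! ### Capacities of unions. -/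

theorem sphereCompl_anti {E F : Set ℂ} (h : E ⊆ F) : sphereCompl F ⊆ sphereCompl E :=
  compl_subset_compl.2 (image_mono h)

theorem SphereAnalyticOn.mono {f : OnePoint ℂ → ℂ} {D D' : Set (OnePoint ℂ)}
    (hf : SphereAnalyticOn f D) (h : D' ⊆ D) : SphereAnalyticOn f D' :=
  ⟨fun z hz => hf.1 z (h hz), fun hz => hf.2 (h hz)⟩

theorem Hinfty_mono {D D' : Set (OnePoint ℂ)} (h : D' ⊆ D) : Hinfty D ⊆ Hinfty D' :=
  fun _ hf => ⟨hf.1.mono h, hf.2.imp fun _ hC p hp => hC p (h hp)⟩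

theorem gamma_mono {E F : Set ℂ} (h : E ⊆ F) : gamma E ≤ gamma F := by
  refine sSup_le_sSup ?_
  rintro _ ⟨f, hf, hb, rfl⟩
  exact ⟨f, Hinfty_mono (sphereCompl_anti h) hf, fun p hp => hb p (sphereCompl_anti h hp), rfl⟩

theorem alpha_mono {E F : Set ℂ} (h : E ⊆ F) : alpha E ≤ alpha F := by
  refine sSup_le_sSup ?_
  rintro _ ⟨f, ⟨hf, hc⟩, hb, rfl⟩
  exact ⟨f, ⟨Hinfty_mono (sphereCompl_anti h) hf, hc⟩, hb, rfl⟩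

theorem compl_union_eq_sdiff (E F : Set ℂ) : (E ∪ F)ᶜ = Fᶜ \ E := by
  rw [compl_union, inter_comm, sdiff_eq]

/-- Extending a competitor for `E ∪ F` across `E` gives a competitor for `F` that is unchanged near
`∞`, so it has the same derivative there. -/
theorem gamma_union_eq {F : Set ℂ} (hE : IsCompact E) (hγ : gamma E = 0) (hF : IsCompact F) :
    gamma (E ∪ F) = gamma F := by
  refine le_antisymm (sSup_le ?_) (gamma_mono subset_union_right)
  rintro _ ⟨f, ⟨hf, -⟩, hb, rfl⟩
  have hb' := forall_mem_sphereCompl.1 hb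
  obtain ⟨g, hg, hgb, hgf⟩ := exists_analytic_extension (f := fun z : ℂ => f z) (C := 1) hE hγ
    hF.isClosed.isOpen_compl
    (fun z hz => hf.1 z (coe_mem_sphereCompl.2 (by rwa [← compl_union_eq_sdiff] at hz)))
    (fun z hz => hb'.2 z (by rwa [← compl_union_eq_sdiff] at hz))
  rw [← compl_union_eq_sdiff] at hgf
  have hev : ∀ᶠ z in Bornology.cobounded ℂ, g z = f z := by
    filter_upwards [Bornology.isBounded_def.1 (hE.union hF).isBounded] with z hz
    exact hgf hz
  have hlim := tendsto_derivInfty (hf.2 infty_mem_sphereCompl)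
  have hd : derivInfty (sphereExtend g (f ∞)) = derivInfty f := by
    refine derivInfty_eq_of_tendsto (hlim.congr' ?_)
    filter_upwards [hev] with z hz
    simp [hz]
  -- `f z - f ∞` is the convergent product `z * (f z - f ∞)` times `z⁻¹`.
  have hginf : Tendsto g (Bornology.cobounded ℂ) (𝓝 (f ∞)) := by
    have h1 := (hlim.mul tendsto_inv₀_cobounded).add_const (f ∞)
    rw [mul_zero, zero_add] at h1
    refine h1.congr' ?_
    filter_upwards [hev, Bornology.eventually_ne_cobounded (0 : ℂ)] with z hz hz0
    rw [hz]
    field_simp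
    ring
  have hgb' : ∀ p ∈ sphereCompl F, ‖sphereExtend g (f ∞) p‖ ≤ 1 :=
    forall_mem_sphereCompl.2 ⟨hb'.1, fun z hz => hgb z hz⟩
  exact le_sSup ⟨_, ⟨sphereAnalyticOn_sphereExtend hF.isBounded hg hginf, 1, hgb'⟩, hgb',
    by rw [hd]⟩

/-- A competitor for `E ∪ F` is itself one for `F`: it is already defined and continuous on `E`, and
only its analyticity on `E \ F` has to be gained. -/
theorem alpha_union_eq {F : Set ℂ} (hE : IsCompact E) (hα : alpha E = 0) (hF : IsCompact F) :
    alpha (E ∪ F) = alpha F := by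
  refine le_antisymm (sSup_le ?_) (alpha_mono subset_union_right)
  rintro _ ⟨g, ⟨⟨hg, -⟩, hc⟩, hb, rfl⟩
  refine le_sSup ⟨g, ⟨⟨⟨fun z hz => ?_, fun _ => hg.2 infty_mem_sphereCompl⟩, 1, ?_⟩, hc⟩,
    hb, rfl⟩
  · refine analyticOnNhd_of_alpha_eq_zero (f := fun z : ℂ => g z) (C := 1) hE hα
      hF.isClosed.isOpen_compl (hc.comp OnePoint.continuous_coe).continuousOn
      (fun z _ => hb z) (fun z hz => ?_) z (coe_mem_sphereCompl.1 hz)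
    exact hg.1 z (coe_mem_sphereCompl.2 (by rwa [← compl_union_eq_sdiff] at hz))
  · exact forall_mem_sphereCompl.2 ⟨norm_infty_le_of_continuous hc hb, fun z _ => hb z⟩

end AnalyticCapacity

theorem lemma9p1 (E : Set ℂ) (hE : IsCompact E) :
    (AnalyticCapacity.gamma E = 0 → ∀ F : Set ℂ, IsCompact F →
      AnalyticCapacity.gamma (E ∪ F) = AnalyticCapacity.gamma F) ∧
    (AnalyticCapacity.alpha E = 0 → ∀ F : Set ℂ, IsCompact F →
      AnalyticCapacity.alpha (E ∪ F) = AnalyticCapacity.alpha F) ∧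
    (AnalyticCapacity.gamma E = 0 → ∀ U : Set ℂ, IsOpen U → ∀ f : ℂ → ℂ,
      AnalyticOnNhd ℂ f (U \ E) → (∃ C : ℝ, ∀ z ∈ U \ E, ‖f z‖ ≤ C) →
      ∃ g : ℂ → ℂ, AnalyticOnNhd ℂ g U ∧ (∃ C : ℝ, ∀ z ∈ U, ‖g z‖ ≤ C) ∧
        Set.EqOn g f (U \ E)) ∧
    (AnalyticCapacity.alpha E = 0 → ∀ U : Set ℂ, IsOpen U → ∀ f : ℂ → ℂ,
      ContinuousOn f U → (∃ C : ℝ, ∀ z ∈ U, ‖f z‖ ≤ C) →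
      AnalyticOnNhd ℂ f (U \ E) → AnalyticOnNhd ℂ f U) := by
  refine ⟨fun hγ F hF => AnalyticCapacity.gamma_union_eq hE hγ hF,
    fun hα F hF => AnalyticCapacity.alpha_union_eq hE hα hF, ?_, ?_⟩
  · rintro hγ U hU f hf ⟨C, hC⟩
    obtain ⟨g, hg, hb, heq⟩ := AnalyticCapacity.exists_analytic_extension hE hγ hU hf hC
    exact ⟨g, hg, ⟨C, hb⟩, heq⟩
  · rintro hα U hU f hc ⟨C, hC⟩ hf
    exact AnalyticCapacity.analyticOnNhd_of_alpha_eq_zero hE hα hU hc hC hf
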